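/- For an integer $m\ge 0$, let $B(m)$ denote the number of triples $(\pi_1,\pi_2,\pi_3)$ of (possibly empty) integer partitions whose parts sum to $m$ in total, such that the parts of $\pi_1$ are distinct and odd, the parts of $\pi_2$ are distinct and odd, and the parts of $\pi_3$ are all divisible by $4$; put $B(m)=0$ for $m<0$. Then for all integers $n\ge 0$ and all $j\in\{1,2\}$, $$\sum_{k=-\infty}^{\infty}(-1)^k\,B\bigl(9n+3j+2-6k(3k+1)\bigr)\equiv 0\pmod 3,$$ where the sum has only finitely many nonzero terms. -/

import Mathlib

/-- The possible sizes `(a, b, c)` of the three components of a partition triple of `n`,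
that is, the triples of natural numbers with `a + b + c = n`. -/
def tripleSizes (n : ℕ) : Finset (ℕ × ℕ × ℕ) :=
  {s ∈ Finset.range (n + 1) ×ˢ Finset.range (n + 1) ×ˢ Finset.range (n + 1) |
    s.1 + s.2.1 + s.2.2 = n}

theorem mem_tripleSizes {n : ℕ} {s : ℕ × ℕ × ℕ} :
    s ∈ tripleSizes n ↔ s.1 + s.2.1 + s.2.2 = n := by
  simp only [tripleSizes, Finset.mem_filter, Finset.mem_product, Finset.mem_range]
  omega

/-- The partition triples `(π₁, π₂, π₃)` of `n` (the sum of all the parts of the three partitions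
is `n`) such that `π₁` and `π₂` have distinct odd parts, and all parts of `π₃` are
divisible by `4`. A component may be the empty partition. -/
def linAnalogueTriples (n : ℕ) :
    Finset (Σ s : ℕ × ℕ × ℕ,
      Nat.Partition s.1 × Nat.Partition s.2.1 × Nat.Partition s.2.2) :=
  (tripleSizes n).sigma fun s =>
    Nat.Partition.oddDistincts s.1 ×ˢ Nat.Partition.oddDistincts s.2.1 ×ˢ
      Nat.Partition.restricted s.2.2 (fun i => 4 ∣ i)

/-- The restricted partition function `B`, the number of these partition triples, extended
by `B m = 0` to negative integers `m`. -/
def linAnalogueB (m : ℤ) : ℤ :=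
  if m < 0 then 0 else ((linAnalogueTriples m.toNat).card : ℤ)

/-!
The proof identifies the alternating sum, modulo `3`, with a coefficient of a product of two theta
series. Write `E d = ∏ (1 - X ^ (d * i))` over `i ≥ 1` and `G = ∏ (1 + X ^ (2 * i + 1))` over
`i ≥ 0`. The generating function of `B` is `G ^ 2 / E 4`, and by the pentagonal number theorem the
alternating sum is a coefficient of `(G ^ 2 / E 4) * E 12`. Over `ZMod 3` we have
`E 12 = E 4 ^ 3`, so this series equals `G ^ 2 * E 4 ^ 2`.

The Jacobi triple product gives `E 2 * G ^ 2 = ∑ X ^ (x ^ 2)` and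
`E 2 * (2 * K ^ 2) = ∑ X ^ (y ^ 2 + y)`, sums over the integers, where
`K = ∏ (1 + X ^ (2 * i))` over `i ≥ 1`. Since `K * E 2 = E 4`, the product of these two theta
series is `2 * G ^ 2 * E 4 ^ 2`. A nonzero coefficient in degree `N` requires
`N = x ^ 2 + y ^ 2 + y`, that is `4 * N + 1 = (2 * x) ^ 2 + (2 * y + 1) ^ 2`. For
`N = 9 * n + 3 * j + 2` the left side is divisible by `3` but not by `9`, which is impossible for a
sum of two squares. As `2` is invertible modulo `3`, the coefficient vanishes.

The required case of the triple product is `hasSum_X_pow_of_hasProd`, obtained as a coefficientwise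
limit of the `q`-binomial theorem `prod_add_mul_pow_eq_sum_qBinom`. The two halves of the argument
meet in `exists_theta_mul_theta_eq` and `hasSum_coeff_mul_expand_pentagonalSeries`.
-/

open PowerSeries Finset Filter
open scoped PowerSeries.WithPiTopology Topology

/-! ### Gaussian binomial coefficients -/

/-- The Gaussian binomial coefficient `[N choose k]` evaluated at an element `Q` of a commutative
ring. It is defined by the `q`-Pascal recursion, so that no division is needed. -/
def qBinom {R : Type*} [CommRing R] (Q : R) : ℕ → ℕ → R
  | _, 0 => 1
  | 0, _ + 1 => 0
  | N + 1, k + 1 => qBinom Q N k + Q ^ (k + 1) * qBinom Q N (k + 1)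

section qBinom

variable {R : Type*} [CommRing R] (Q : R)

@[simp]
theorem qBinom_zero_right (N : ℕ) : qBinom Q N 0 = 1 := by
  cases N <;> rfl

theorem qBinom_succ_succ (N k : ℕ) :
    qBinom Q (N + 1) (k + 1) = qBinom Q N k + Q ^ (k + 1) * qBinom Q N (k + 1) := rfl

theorem qBinom_eq_zero_of_lt {N k : ℕ} (h : N < k) : qBinom Q N k = 0 := by
  induction N generalizing k with
  | zero => obtain ⟨k, rfl⟩ := Nat.exists_eq_add_one_of_ne_zero h.ne'; rfl
  | succ N ih =>
    obtain ⟨k, rfl⟩ := Nat.exists_eq_add_one_of_ne_zero (Nat.ne_zero_of_lt h)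
    rw [qBinom_succ_succ, ih (by omega), ih (by omega)]
    ring

/-- The `q`-binomial theorem of Cauchy, homogenized by `y` because `X` is not invertible in the
power series ring to which it is applied. -/
theorem prod_add_mul_pow_eq_sum_qBinom (N : ℕ) (x y : R) :
    ∏ i ∈ range N, (y + x * Q ^ i) =
      ∑ k ∈ range (N + 1), qBinom Q N k * Q ^ (k.choose 2) * x ^ k * y ^ (N - k) := by
  induction N generalizing x with
  | zero => simp
  | succ N ih =>
    have hshift : ∏ i ∈ range N, (y + x * Q ^ (i + 1)) =
        ∏ i ∈ range N, (y + (x * Q) * Q ^ i) :=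
      prod_congr rfl fun i _ => by ring
    rw [prod_range_succ', hshift, ih, pow_zero, mul_one, mul_add, sum_range_succ' _ (N + 1)]
    have hlast : ∑ k ∈ range (N + 1), qBinom Q N (k + 1) * Q ^ (k + 1) * Q ^ ((k + 1).choose 2) *
          x ^ (k + 1) * y ^ (N - k) + y ^ (N + 1) =
        (∑ k ∈ range (N + 1), qBinom Q N k * Q ^ (k.choose 2) * (x * Q) ^ k * y ^ (N - k)) * y := by
      rw [sum_range_succ, qBinom_eq_zero_of_lt Q (Nat.lt_succ_self N), sum_range_succ', add_mul,
        sum_mul]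
      simp only [zero_mul, add_zero, qBinom_zero_right, Nat.choose_zero_succ, pow_zero, one_mul,
        Nat.sub_zero, ← pow_succ]
      congr 1
      refine sum_congr rfl fun k hk => ?_
      have : N - k = N - (k + 1) + 1 := by have := mem_range.mp hk; omega
      rw [this]
      ring
    rw [← hlast, add_comm, ← add_assoc, sum_mul, ← sum_add_distrib]
    simp only [qBinom_zero_right, Nat.choose_zero_succ, pow_zero, one_mul, Nat.sub_zero,
      Nat.add_sub_add_right]
    congr 1
    · refine sum_congr rfl fun k _ => ?_
      rw [qBinom_succ_succ, Nat.choose_succ_succ' k 1, Nat.choose_one_right]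
      ring

/-- The quotient formula for Gaussian binomial coefficients, with denominators cleared. -/
theorem qBinom_mul_prod_mul_prod {N k : ℕ} (h : k ≤ N) :
    qBinom Q N k * (∏ i ∈ range k, (1 - Q ^ (i + 1))) * ∏ i ∈ range (N - k), (1 - Q ^ (i + 1)) =
      ∏ i ∈ range N, (1 - Q ^ (i + 1)) := by
  induction N generalizing k with
  | zero => obtain rfl : k = 0 := by omega
            simp
  | succ N ih =>
    rcases k with _ | k
    · simp
    · have h1 := ih (k := k) (by omega)
      rw [qBinom_succ_succ, Nat.add_sub_add_right, prod_range_succ _ N, prod_range_succ _ k]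
      rcases (show k = N ∨ k + 1 ≤ N by omega) with rfl | hk
      · rw [qBinom_eq_zero_of_lt Q (Nat.lt_succ_self k)]
        linear_combination (1 - Q ^ (k + 1)) * h1
      · have h2 := ih hk
        have hsub : N - k = N - (k + 1) + 1 := by omega
        rw [hsub, prod_range_succ] at h1 ⊢
        rw [prod_range_succ] at h2
        have hpow : Q ^ (N + 1) = Q ^ (k + 1) * Q ^ (N - (k + 1) + 1) := by
          rw [← pow_add]; congr 1; omega
        rw [hpow]
        linear_combination (1 - Q ^ (k + 1)) * h1 +
          Q ^ (k + 1) * (1 - Q ^ (N - (k + 1) + 1)) * h2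

end qBinom

/-! ### The Jacobi triple product -/

section TripleProduct

variable {R : Type*} [CommRing R]

theorem sum_range_sub_eq_sum_Icc {M : Type*} [AddCommMonoid M] (n : ℕ) (f : ℕ → ℤ → M) :
    ∑ k ∈ range (2 * n + 1), f k (k - n) = ∑ m ∈ Icc (-n : ℤ) n, f (n + m).toNat m := by
  refine sum_nbij' (fun k => (k : ℤ) - n) (fun m => (n + m).toNat) ?_ ?_ ?_ ?_ ?_
  · intro k hk; simp only [mem_range] at hk; simp only [mem_Icc]; omega
  · intro m hm; simp only [mem_Icc] at hm; simp only [mem_range]; omega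
  · intro k _; omega
  · intro m hm; simp only [mem_Icc] at hm; omega
  · intro k _; congr 1; omega

/-- The finite form of the Jacobi triple product: the `q`-binomial theorem for `2 * n` factors, with
the common power of `X` cancelled. The identity `2 * e m = (s + t) * m ^ 2 + (t - s) * m` encodes
the quadratic exponent, whose coefficients may be half-integers, as a function with natural values. -/
theorem prod_one_add_X_pow_eq_sum_qBinom {s t : ℕ} {e : ℤ → ℕ}
    (he : ∀ m : ℤ, 2 * (e m : ℤ) = (s + t) * m ^ 2 + (t - s) * m) {n : ℕ} (hn : n ≠ 0) :
    ∏ i ∈ range n, ((1 + X ^ ((s + t) * i + s)) * (1 + X ^ ((s + t) * i + t)) : R⟦X⟧) =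
      ∑ m ∈ Icc (-n : ℤ) n, qBinom (X ^ (s + t)) (2 * n) (n + m).toNat * X ^ e m := by
  obtain ⟨n, rfl⟩ := Nat.exists_eq_add_one_of_ne_zero hn
  set d := s + t with hd
  -- The exponent of `y` centres the Cauchy product at the middle pair of factors.
  obtain ⟨a, ha⟩ : ∃ a, a = d * n + s := ⟨_, rfl⟩
  obtain ⟨c, hc⟩ : ∃ c, c = (∑ i ∈ range (n + 1), d * i) + (n + 1) * a := ⟨_, rfl⟩
  have hc2 : 2 * (c : ℤ) = d * n * (n + 1) + 2 * (n + 1) * a := by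
    have h : ∀ l : ℕ, 2 * ((∑ i ∈ range (l + 1), d * i : ℕ) : ℤ) = d * l * (l + 1) := by
      intro l
      induction l with
      | zero => simp
      | succ l ih => rw [sum_range_succ]; push_cast at ih ⊢; linear_combination ih
    rw [hc]
    push_cast
    have := h n
    push_cast at this
    linear_combination this
  have hprod := prod_add_mul_pow_eq_sum_qBinom (X ^ d : R⟦X⟧) (2 * (n + 1)) 1 (X ^ a)
  have hleft : ∏ i ∈ range (2 * (n + 1)), ((X ^ a : R⟦X⟧) + 1 * (X ^ d) ^ i) = X ^ c *
      ∏ i ∈ range (n + 1), ((1 + X ^ (d * i + s)) * (1 + X ^ (d * i + t)) : R⟦X⟧) := by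
    rw [two_mul, prod_range_add, ← prod_range_reflect, prod_mul_distrib, hc,
      pow_add X (∑ i ∈ range (n + 1), d * i),
      mul_comm (n + 1) a, pow_mul X a, ← prod_pow_eq_pow_sum,
      ← prod_range_reflect (fun i => (X : R⟦X⟧) ^ (d * i))]
    have h1 : ∏ j ∈ range (n + 1), ((X : R⟦X⟧) ^ a + 1 * (X ^ d) ^ (n + 1 - 1 - j)) =
        (∏ j ∈ range (n + 1), (X : R⟦X⟧) ^ (d * (n + 1 - 1 - j))) *
          ∏ j ∈ range (n + 1), (1 + X ^ (d * j + s)) := by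
      rw [← prod_mul_distrib]
      refine prod_congr rfl fun j hj => ?_
      obtain ⟨l, rfl⟩ := Nat.exists_eq_add_of_le (Nat.lt_succ_iff.mp (mem_range.mp hj))
      rw [ha, Nat.add_sub_cancel, Nat.add_sub_cancel_left]
      ring
    have h2 : ∏ j ∈ range (n + 1), ((X : R⟦X⟧) ^ a + 1 * (X ^ d) ^ (n + 1 + j)) =
        (X ^ a) ^ (n + 1) * ∏ j ∈ range (n + 1), (1 + X ^ (d * j + t)) := by
      rw [← card_range (n + 1), ← prod_const, card_range, ← prod_mul_distrib]
      refine prod_congr rfl fun j _ => ?_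
      rw [ha, hd]
      ring
    rw [h1, h2]
    ring
  have hright : ∑ k ∈ range (2 * (n + 1) + 1), qBinom (X ^ d : R⟦X⟧) (2 * (n + 1)) k *
        (X ^ d) ^ (k.choose 2) * 1 ^ k * (X ^ a) ^ (2 * (n + 1) - k) =
      X ^ c * ∑ m ∈ Icc (-(n + 1 : ℕ) : ℤ) (n + 1 : ℕ),
        qBinom (X ^ d) (2 * (n + 1)) ((n + 1 : ℕ) + m).toNat * X ^ e m := by
    rw [← sum_range_sub_eq_sum_Icc (n + 1)
      (fun k m => qBinom (X ^ d : R⟦X⟧) (2 * (n + 1)) k * X ^ e m), mul_sum]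
    refine sum_congr rfl fun k hk => ?_
    have hk' : k ≤ 2 * (n + 1) := Nat.lt_succ_iff.mp (mem_range.mp hk)
    have hexp : d * k.choose 2 + a * (2 * (n + 1) - k) = c + e (k - (n + 1 : ℕ)) := by
      have h1 := he (k - (n + 1 : ℕ))
      have h2 : 2 * (k.choose 2 : ℤ) = k * (k - 1) := by
        have := Finset.sum_range_id_mul_two k
        rw [Finset.sum_range_id, ← Nat.choose_two_right] at this
        rcases k with _ | k
        · simp
        · push_cast at this ⊢
          zify at this
          linear_combination this
      zify [hk']
      rw [← mul_right_inj' (two_ne_zero' ℤ)]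
      push_cast at h1 ⊢
      have ha' : (a : ℤ) = d * n + s := by exact_mod_cast ha
      have hd' : (d : ℤ) = s + t := by exact_mod_cast hd
      rw [ha', hd'] at hc2 ⊢
      linear_combination (s + t : ℤ) * h2 - h1 - hc2
    have : ((X : R⟦X⟧) ^ d) ^ (k.choose 2) * (X ^ a) ^ (2 * (n + 1) - k) =
        X ^ c * X ^ e (k - (n + 1 : ℕ)) := by
      rw [← pow_mul, ← pow_mul, ← pow_add, ← pow_add, hexp]
    rw [one_pow, mul_one]
    linear_combination qBinom (X ^ d : R⟦X⟧) (2 * (n + 1)) k * this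
  rw [hleft, hright] at hprod
  exact X_pow_mul_cancel hprod

/-- A Gaussian binomial coefficient in the variable `X ^ d`, far from both ends of its row, agrees
to high order with the inverse of the infinite product `∏ (1 - X ^ (d * (i + 1)))`. -/
theorem X_pow_dvd_qBinom_mul_prod_sub_one {d : ℕ} (hd : d ≠ 0) {M N k n : ℕ} (hk : M ≤ k)
    (hN : k + M ≤ N) (hn : M ≤ n) :
    (X : R⟦X⟧) ^ M ∣ qBinom (X ^ d) N k * ∏ i ∈ range n, (1 - (X ^ d) ^ (i + 1)) - 1 := by
  set P : ℕ → R⟦X⟧ := fun j => ∏ i ∈ range j, (1 - (X ^ d) ^ (i + 1)) with hP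
  let π := Ideal.Quotient.mk (Ideal.span {(X : R⟦X⟧) ^ M})
  have hconst : ∀ j, M ≤ j → π (P j) = π (P M) := by
    intro j hj
    induction j, hj using Nat.le_induction with
    | base => rfl
    | succ j hj ih =>
      have hzero : π ((X ^ d) ^ (j + 1)) = 0 := by
        rw [Ideal.Quotient.eq_zero_iff_mem, Ideal.mem_span_singleton, ← pow_mul]
        exact pow_dvd_pow _ (by nlinarith [Nat.pos_of_ne_zero hd])
      rw [hP]
      dsimp only
      rw [prod_range_succ, map_mul, map_sub, hzero, map_one, sub_zero, mul_one]
      exact ih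
  -- Modulo `X ^ M` all long partial products agree with this one, so the quotient formula
  -- becomes `b * u * u = u` with `u` a unit.
  have hunit : IsUnit (π (P M)) := by
    refine IsUnit.map π ((isUnit_iff_constantCoeff).mpr ?_)
    simp [hP, map_prod, hd]
  have hmul : π (qBinom (X ^ d) N k) * π (P M) = 1 := by
    have h := congrArg π (qBinom_mul_prod_mul_prod (X ^ d : R⟦X⟧) (show k ≤ N by omega))
    rw [map_mul, map_mul] at h
    have h' : π (qBinom (X ^ d) N k) * π (P k) * π (P (N - k)) = π (P N) := h
    rw [hconst k hk, hconst (N - k) (by omega), hconst N (by omega)] at h'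
    exact hunit.mul_right_cancel (by rw [h', one_mul])
  rw [← Ideal.mem_span_singleton, ← Ideal.Quotient.eq_zero_iff_mem]
  change π (qBinom (X ^ d) N k * P n - 1) = 0
  rw [map_sub, map_mul, hconst n hn, hmul, map_one, sub_self]

/-- The exponents in the triple product grow at least linearly, so only finitely many terms
contribute to a given coefficient. -/
theorem abs_le_exponent_add_one {s t : ℕ} (hst : s + t ≠ 0) {e : ℤ → ℕ}
    (he : ∀ m : ℤ, 2 * (e m : ℤ) = (s + t) * m ^ 2 + (t - s) * m) (m : ℤ) :
    |m| ≤ e m + 1 := by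
  have h := he m
  have hd : (1 : ℤ) ≤ s + t := by omega
  rcases le_total 0 m with hm | hm
  · rw [abs_of_nonneg hm]
    rcases hm.eq_or_lt with rfl | hm
    · omega
    · nlinarith [mul_nonneg (sub_nonneg.mpr hd) (mul_nonneg hm.le (show 0 ≤ m - 1 by omega)),
        mul_nonneg (show (0 : ℤ) ≤ t by omega) hm.le, sq_nonneg (m - 2), sq_nonneg (m - 1)]
  · rw [abs_of_nonpos hm]
    rcases hm.eq_or_lt with rfl | hm
    · omega
    · nlinarith [mul_nonneg (sub_nonneg.mpr hd)
          (mul_nonneg (neg_nonneg.mpr hm.le) (show 0 ≤ -m - 1 by omega)),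
        mul_nonneg (show (0 : ℤ) ≤ s by omega) (neg_nonneg.mpr hm.le), sq_nonneg (m + 2),
        sq_nonneg (m + 1)]

/-- Once `n` is large compared with `D`, the Gaussian binomial coefficients disappear from the
degree `D` part of the finite triple product. -/
theorem coeff_prod_mul_prod_one_add_X_pow {s t : ℕ} (hst : s + t ≠ 0) {e : ℤ → ℕ}
    (he : ∀ m : ℤ, 2 * (e m : ℤ) = (s + t) * m ^ 2 + (t - s) * m) {D n : ℕ}
    (hn : 2 * D + 3 ≤ n) :
    coeff D ((∏ i ∈ range n, (1 - (X ^ (s + t)) ^ (i + 1))) *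
        ∏ i ∈ range n, ((1 + X ^ ((s + t) * i + s)) * (1 + X ^ ((s + t) * i + t)) : R⟦X⟧)) =
      ∑ m ∈ Icc (-n : ℤ) n, coeff D ((X : R⟦X⟧) ^ e m) := by
  rw [prod_one_add_X_pow_eq_sum_qBinom he (by omega), mul_sum, map_sum]
  refine sum_congr rfl fun m hm => ?_
  rw [mem_Icc] at hm
  rw [← sub_eq_zero, ← map_sub]
  refine X_pow_dvd_iff.mp ?_ D (Nat.lt_succ_self D)
  -- Large exponents vanish in degree `D`; for the others `m` stays near the middle of the row.
  have hfactor : (∏ i ∈ range n, (1 - (X ^ (s + t)) ^ (i + 1))) *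
        (qBinom (X ^ (s + t)) (2 * n) (n + m).toNat * X ^ e m) - X ^ e m =
      (qBinom (X ^ (s + t)) (2 * n) (n + m).toNat *
        (∏ i ∈ range n, (1 - (X ^ (s + t)) ^ (i + 1))) - 1) * (X : R⟦X⟧) ^ e m := by ring
  rw [hfactor]
  rcases le_or_gt (D + 1) (e m) with h | h
  · exact (pow_dvd_pow _ h).mul_left _
  · have habs := abs_le_exponent_add_one hst he m
    have := abs_le.mp habs
    exact (X_pow_dvd_qBinom_mul_prod_sub_one hst (by omega) (by omega) (by omega)).mul_right _

variable [TopologicalSpace R] [IsTopologicalRing R] [T2Space R]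

/-- The **Jacobi triple product** for power series, with its free variable specialized to a power
of `X`. -/
theorem hasSum_X_pow_of_hasProd {s t : ℕ} (hst : s + t ≠ 0) {e : ℤ → ℕ}
    (he : ∀ m : ℤ, 2 * (e m : ℤ) = (s + t) * m ^ 2 + (t - s) * m) {E F G : R⟦X⟧}
    (hE : HasProd (fun i : ℕ => (1 - X ^ ((s + t) * (i + 1)) : R⟦X⟧)) E)
    (hF : HasProd (fun i : ℕ => (1 + X ^ ((s + t) * i + s) : R⟦X⟧)) F)
    (hG : HasProd (fun i : ℕ => (1 + X ^ ((s + t) * i + t) : R⟦X⟧)) G) :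
    HasSum (fun m : ℤ => (X : R⟦X⟧) ^ e m) (E * (F * G)) := by
  rw [WithPiTopology.hasSum_iff_hasSum_coeff]
  intro D
  have hsub : ∀ n : ℕ, 2 * D + 3 ≤ n → ∀ m ∉ Icc (-n : ℤ) n, coeff D ((X : R⟦X⟧) ^ e m) = 0 := by
    intro n hn m hm
    rw [coeff_X_pow, if_neg]
    rintro rfl
    have := abs_le.mp (abs_le_exponent_add_one hst he m)
    exact hm (mem_Icc.mpr (by omega))
  have hlim : Tendsto (fun n : ℕ => coeff D ((∏ i ∈ range n, (1 - (X ^ (s + t)) ^ (i + 1))) *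
        ∏ i ∈ range n, ((1 + X ^ ((s + t) * i + s)) * (1 + X ^ ((s + t) * i + t)) : R⟦X⟧)))
      atTop (𝓝 (coeff D (E * (F * G)))) := by
    refine ((WithPiTopology.continuous_coeff R D).tendsto _).comp ?_
    simp only [← pow_mul]
    exact hE.tendsto_prod_nat.mul (hF.mul hG).tendsto_prod_nat
  have hfin := hasSum_sum_of_ne_finset_zero (L := .unconditional ℤ) (hsub _ le_rfl)
  have hconst : Tendsto (fun n : ℕ => coeff D ((∏ i ∈ range n, (1 - (X ^ (s + t)) ^ (i + 1))) *
        ∏ i ∈ range n, ((1 + X ^ ((s + t) * i + s)) * (1 + X ^ ((s + t) * i + t)) : R⟦X⟧)))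
      atTop (𝓝 (∑ m ∈ Icc (-(2 * D + 3 : ℕ) : ℤ) (2 * D + 3 : ℕ), coeff D ((X : R⟦X⟧) ^ e m))) := by
    refine tendsto_atTop_of_eventually_const (i₀ := 2 * D + 3) fun n hn => ?_
    rw [coeff_prod_mul_prod_one_add_X_pow hst he hn]
    exact (hasSum_sum_of_ne_finset_zero (hsub n hn)).unique hfin
  rw [tendsto_nhds_unique hlim hconst]
  exact hfin

end TripleProduct

/-! ### Generating functions of restricted partitions -/

section GeneratingFunctions

variable (R : Type*) [CommRing R]

theorem hasProd_powerSeriesMk_card_oddDistincts [TopologicalSpace R] [T2Space R] :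
    HasProd (fun i : ℕ => (1 + X ^ (2 * i + 1) : R⟦X⟧))
      (PowerSeries.mk fun n => (#(Nat.Partition.oddDistincts n) : R)) := by
  have h := Nat.Partition.hasProd_genFun (fun i c => if ¬ Even i ∧ c < 2 then (1 : R) else 0)
  -- The factor with index `i` belongs to the part `i + 1`, so odd parts have even indices.
  have hinj : Function.Injective fun i : ℕ => 2 * i := fun a b h => by simpa using h
  have hterm : ∀ i : ℕ, (1 + ∑' j, (if ¬ Even (i + 1) ∧ j + 1 < 2 then (1 : R) else 0) •
      X ^ ((i + 1) * (j + 1)) : R⟦X⟧) = if Even i then 1 + X ^ (i + 1) else 1 := by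
    intro i
    rw [tsum_eq_single 0 (fun j hj => by rw [if_neg (by omega), zero_smul])]
    by_cases hi : Even i <;> simp [hi, Nat.even_add_one]
  simp only [hterm] at h
  rw [← hinj.hasProd_iff] at h
  · convert! h using 1
    · ext1 i
      simp
    · simp_rw [Nat.Partition.genFun, Nat.Partition.oddDistincts, Nat.Partition.odds,
        Nat.Partition.distincts, Nat.Partition.restricted, ← filter_and, card_filter,
        Finsupp.prod, prod_boole]
      ext n
      simp only [coeff_mk, Nat.cast_sum, Nat.cast_ite, Nat.cast_one, Nat.cast_zero]
      refine sum_congr rfl fun p _ => if_congr ?_ rfl rfl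
      simp only [Multiset.toFinsupp_support, Multiset.mem_toFinset, Multiset.toFinsupp_apply,
        Multiset.nodup_iff_count_le_one]
      constructor
      · exact fun ⟨h1, h2⟩ i hi => ⟨h1 i hi, Nat.lt_succ_of_le (h2 i)⟩
      · refine fun h => ⟨fun i hi => (h i hi).1, fun i => ?_⟩
        by_cases hi : i ∈ p.parts
        · exact Nat.le_of_lt_succ (h i hi).2
        · rw [Multiset.count_eq_zero_of_notMem hi]
          exact zero_le_one
  · intro i hi
    rw [if_neg]
    rintro ⟨k, rfl⟩
    exact hi ⟨k, by dsimp only; ring⟩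

theorem continuous_expand [TopologicalSpace R] {d : ℕ} (hd : d ≠ 0) :
    Continuous (expand (R := R) d hd) := by
  refine continuous_iff_continuousAt.mpr fun f => ?_
  rw [ContinuousAt, WithPiTopology.tendsto_iff_coeff_tendsto]
  intro n
  simp only [coeff_expand]
  split_ifs
  · exact (WithPiTopology.continuous_coeff R _).continuousAt
  · exact tendsto_const_nhds

theorem hasProd_expand_pentagonalSeries [TopologicalSpace R] {d : ℕ} (hd : d ≠ 0) :
    HasProd (fun i : ℕ => (1 - X ^ (d * (i + 1)) : R⟦X⟧)) (expand d hd (pentagonalSeries R)) := by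
  have h := (WithPiTopology.hasProd_one_sub_X_pow R).map (expand (R := R) d hd)
    (continuous_expand R hd)
  convert! h using 1
  ext1 i
  simp [pow_mul]

/-- The generating function of partitions into multiples of `d` is inverse to
`∏ (1 - X ^ (d * (i + 1)))`. -/
theorem powerSeriesMk_card_restricted_dvd_mul_expand [TopologicalSpace R] [IsTopologicalRing R]
    [T2Space R] {d : ℕ} (hd : d ≠ 0) :
    (PowerSeries.mk fun n => (#(Nat.Partition.restricted n (d ∣ ·)) : R)) *
      expand d hd (pentagonalSeries R) = 1 := by
  have h := Nat.Partition.hasProd_powerSeriesMk_card_restricted R (d ∣ ·)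
  have hsub : ∀ i : ℕ, d * (i + 1) - 1 + 1 = d * (i + 1) := fun i =>
    Nat.sub_add_cancel (Nat.mul_pos (Nat.pos_of_ne_zero hd) i.succ_pos)
  have hinj : Function.Injective fun i : ℕ => d * (i + 1) - 1 := fun a b hab => by
    have : d * (a + 1) = d * (b + 1) := by
      rw [← hsub, ← hsub b]; exact congrArg (· + 1) hab
    simpa [hd] using this
  rw [← hinj.hasProd_iff] at h
  · refine (h.mul (hasProd_expand_pentagonalSeries R hd)).unique ?_
    convert! hasProd_one using 1
    ext1 i
    simp only [Function.comp_apply, hsub, dvd_mul_right, if_true, pow_mul X (d * (i + 1))]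
    exact WithPiTopology.tsum_pow_mul_one_sub_of_constantCoeff_eq_zero (by simp [hd])
  · intro i hi
    rw [if_neg]
    rintro ⟨k, hk⟩
    rcases k with _ | k
    · simp at hk
    · exact hi ⟨k, by dsimp only; omega⟩

theorem powerSeriesMk_card_linAnalogueTriples :
    (PowerSeries.mk fun n => (#(linAnalogueTriples n) : R)) =
      (PowerSeries.mk fun n => (#(Nat.Partition.oddDistincts n) : R)) ^ 2 *
        PowerSeries.mk fun n => (#(Nat.Partition.restricted n (4 ∣ ·)) : R) := by
  ext n
  rw [pow_two, mul_assoc, coeff_mul, coeff_mk, linAnalogueTriples, card_sigma]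
  simp only [coeff_mul, mul_sum, card_product, coeff_mk]
  rw [Nat.cast_sum, sum_sigma']
  symm
  -- The Cauchy product groups the sizes `(a, b, c)` as `(a, b + c)` and `(b, c)`.
  refine sum_bij' (fun x _ => (x.1.1, x.2.1, x.2.2)) (fun s _ => ⟨(s.1, s.2.1 + s.2.2), s.2⟩)
    ?_ ?_ ?_ ?_ ?_
  · rintro ⟨⟨a, b⟩, c⟩ h
    simp only [mem_sigma, HasAntidiagonal.mem_antidiagonal] at h
    rw [mem_tripleSizes]
    dsimp only at h ⊢
    omega
  · rintro ⟨a, b, c⟩ h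
    rw [mem_tripleSizes] at h
    simp only [mem_sigma, HasAntidiagonal.mem_antidiagonal, and_true]
    rw [← h, add_assoc]
  · rintro ⟨⟨a, b⟩, c, d⟩ h
    simp only [mem_sigma, HasAntidiagonal.mem_antidiagonal] at h
    dsimp only at h ⊢
    rw [h.2]
  · rintro ⟨a, b, c⟩ h
    rfl
  · rintro ⟨⟨a, b⟩, c, d⟩ h
    push_cast
    rfl

end GeneratingFunctions

theorem coeff_eq_zero_of_hasSum_X_pow {R ι : Type*} [CommRing R] [TopologicalSpace R] [T2Space R]
    {e : ι → ℕ} {f : R⟦X⟧} (h : HasSum (fun m => (X : R⟦X⟧) ^ e m) f) {n : ℕ}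
    (hn : ∀ m, e m ≠ n) : coeff n f = 0 := by
  have h' := (WithPiTopology.hasSum_iff_hasSum_coeff R).mp h n
  have hzero : ∀ m, coeff n ((X : R⟦X⟧) ^ e m) = 0 := fun m => by
    rw [coeff_X_pow, if_neg (hn m).symm]
  simp only [hzero] at h'
  exact h'.unique hasSum_zero

/-- Four times the equation plus one would write a number divisible by `3` but not by `9` as a sum
of two squares. -/
theorem sq_add_sq_add_self_ne {n j : ℕ} (hj : j = 1 ∨ j = 2) (x y : ℤ) :
    x ^ 2 + (y ^ 2 + y) ≠ 9 * n + 3 * j + 2 := by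
  intro h
  have key : (2 * x) ^ 2 + (2 * y + 1) ^ 2 = 3 * (12 * n + 4 * j + 3) := by
    linear_combination 4 * h
  have hdvd : (3 : ℤ) ∣ 2 * x ∧ (3 : ℤ) ∣ 2 * y + 1 := by
    generalize 2 * x = a at *
    generalize 2 * y + 1 = b at *
    have hmod : (a ^ 2 + b ^ 2) % 3 = 0 := by omega
    rcases (by omega : a % 3 = 0 ∨ a % 3 = 1 ∨ a % 3 = 2) with ha | ha | ha <;>
      rcases (by omega : b % 3 = 0 ∨ b % 3 = 1 ∨ b % 3 = 2) with hb | hb | hb <;>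
      simp [pow_two, Int.add_emod, Int.mul_emod, ha, hb] at hmod
    omega
  obtain ⟨⟨a, ha⟩, b, hb⟩ := hdvd
  rw [ha, hb] at key
  have : 3 * (a ^ 2 + b ^ 2) = 12 * n + 4 * j + 3 := by linarith
  omega

/-! ### The congruence modulo three -/

section ModThree

variable [TopologicalSpace (ZMod 3)] [IsTopologicalRing (ZMod 3)] [T2Space (ZMod 3)]

/-- Cubing is additive in characteristic `3`, so it sends `1 - X ^ (4 * i)` to `1 - X ^ (12 * i)`. -/
theorem expand_pentagonalSeries_twelve :
    expand 12 (by norm_num) (pentagonalSeries (ZMod 3)) =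
      expand 4 (by norm_num) (pentagonalSeries (ZMod 3)) ^ 3 := by
  have h := hasProd_expand_pentagonalSeries (ZMod 3) (d := 4) (by norm_num)
  rw [pow_succ, pow_two]
  refine (hasProd_expand_pentagonalSeries (ZMod 3) (d := 12) (by norm_num)).unique ?_
  convert! (h.mul h).mul h using 1
  ext1 i
  have h3 : (3 : (ZMod 3)⟦X⟧) = 0 := by
    have : (3 : ZMod 3) = 0 := by decide
    rw [← map_ofNat (C (R := ZMod 3)) 3, this, map_zero]
  linear_combination (X ^ (4 * (i + 1)) - (X ^ (4 * (i + 1))) ^ 2) * h3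

/-- Modulo `3`, twice the generating function of `B` times `∏ (1 - X ^ (12 * (i + 1)))` is a product
of two theta series. -/
theorem exists_theta_mul_theta_eq : ∃ φ θ : (ZMod 3)⟦X⟧,
    HasSum (fun m : ℤ => (X : (ZMod 3)⟦X⟧) ^ (m ^ 2).toNat) φ ∧
    HasSum (fun m : ℤ => (X : (ZMod 3)⟦X⟧) ^ (m ^ 2 + m).toNat) θ ∧
    φ * θ = 2 * ((PowerSeries.mk fun n => (#(linAnalogueTriples n) : ZMod 3)) *
      expand 12 (by norm_num) (pentagonalSeries (ZMod 3))) := by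
  have hG := hasProd_powerSeriesMk_card_oddDistincts (ZMod 3)
  have hE2 := hasProd_expand_pentagonalSeries (ZMod 3) (d := 2) (by norm_num)
  have hE4 := hasProd_expand_pentagonalSeries (ZMod 3) (d := 4) (by norm_num)
  have hH := powerSeriesMk_card_restricted_dvd_mul_expand (ZMod 3) (d := 4) (by norm_num)
  obtain ⟨K, hK⟩ : ∃ K : (ZMod 3)⟦X⟧, HasProd (fun i : ℕ => 1 + X ^ (2 * (i + 1))) K := by
    have h := (Nat.Partition.hasProd_powerSeriesMk_card_countRestricted (ZMod 3)
      (m := 2) (by norm_num)).map (expand (R := ZMod 3) 2 (by norm_num))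
      (continuous_expand (ZMod 3) (by norm_num))
    refine ⟨_, h.congr_fun fun i => ?_⟩
    simp [sum_range_succ, pow_mul]
  have hKE : K * expand 2 (by norm_num) (pentagonalSeries (ZMod 3)) =
      expand 4 (by norm_num) (pentagonalSeries (ZMod 3)) := by
    refine (hK.mul hE2).unique ?_
    convert! hE4 using 1
    ext1 i
    ring
  -- The factor `2` is the term `i = 0`.
  have hK0 : HasProd (fun i : ℕ => (1 + X ^ (2 * i) : (ZMod 3)⟦X⟧)) (2 * K) := by
    have := HasProd.prod_range_mul (f := fun i : ℕ => (1 + X ^ (2 * i) : (ZMod 3)⟦X⟧)) (k := 1) hK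
    simpa [one_add_one_eq_two] using this
  refine ⟨_, _, hasSum_X_pow_of_hasProd (s := 1) (t := 1) (by norm_num) ?_ hE2 hG hG,
    hasSum_X_pow_of_hasProd (s := 0) (t := 2) (by norm_num) ?_ hE2 hK0 hK, ?_⟩
  · intro m
    rw [Int.toNat_of_nonneg (sq_nonneg m)]
    push_cast
    ring
  · intro m
    have : 0 ≤ m ^ 2 + m := by
      rcases le_or_gt 0 m with h | h <;> nlinarith
    rw [Int.toNat_of_nonneg this]
    push_cast
    ring
  · rw [powerSeriesMk_card_linAnalogueTriples, expand_pentagonalSeries_twelve, ← hKE]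
    rw [← hKE] at hH
    linear_combination (-2 * (PowerSeries.mk fun n =>
      (#(Nat.Partition.oddDistincts n) : ZMod 3)) ^ 2 *
      (K * expand 2 (by norm_num) (pentagonalSeries (ZMod 3))) ^ 2) * hH

theorem coeff_linAnalogueTriples_mul_expand_eq_zero {n j : ℕ} (hj : j = 1 ∨ j = 2) :
    coeff (9 * n + 3 * j + 2) ((PowerSeries.mk fun n => (#(linAnalogueTriples n) : ZMod 3)) *
      expand 12 (by norm_num) (pentagonalSeries (ZMod 3))) = 0 := by
  obtain ⟨φ, θ, hφ, hθ, h⟩ := exists_theta_mul_theta_eq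
  have hzero : coeff (9 * n + 3 * j + 2) (φ * θ) = 0 := by
    rw [coeff_mul]
    refine sum_eq_zero fun p hp => ?_
    rw [HasAntidiagonal.mem_antidiagonal] at hp
    by_contra hne
    obtain ⟨hp1, hp2⟩ := ne_zero_and_ne_zero_of_mul hne
    have hx : ∃ x : ℤ, (x ^ 2).toNat = p.1 := by
      by_contra! hx
      exact hp1 (coeff_eq_zero_of_hasSum_X_pow hφ hx)
    have hy : ∃ y : ℤ, (y ^ 2 + y).toNat = p.2 := by
      by_contra! hy
      exact hp2 (coeff_eq_zero_of_hasSum_X_pow hθ hy)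
    obtain ⟨x, hx⟩ := hx
    obtain ⟨y, hy⟩ := hy
    refine sq_add_sq_add_self_ne (n := n) hj x y ?_
    have hx0 := sq_nonneg x
    have hy0 : 0 ≤ y ^ 2 + y := by
      rcases le_or_gt 0 y with h | h <;> nlinarith
    omega
  rw [h, two_mul, map_add, ← two_mul] at hzero
  exact (by decide : ∀ c : ZMod 3, 2 * c = 0 → c = 0) _ hzero

end ModThree

theorem linAnalogueB_eq_zero_of_neg {m : ℤ} (hm : m < 0) : linAnalogueB m = 0 := if_pos hm

theorem finite_support_negOnePow_mul_linAnalogueB (N : ℤ) :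
    (Function.support fun k : ℤ =>
      ((k.negOnePow : ℤˣ) : ℤ) * linAnalogueB (N - 6 * k * (3 * k + 1))).Finite := by
  refine (Set.finite_Icc (-|N|) |N|).subset fun k hk => ?_
  by_contra hk'
  refine hk ?_
  dsimp only
  rw [linAnalogueB_eq_zero_of_neg, mul_zero]
  rw [Set.mem_Icc, ← abs_le, not_le] at hk'
  have h1 := le_abs_self N
  have h2 : |k| ≤ 6 * k * (3 * k + 1) := by
    rcases le_total 0 k with h | h
    · rw [abs_of_nonneg h]; nlinarith
    · rw [abs_of_nonpos h]
      rcases h.eq_or_lt with rfl | h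
      · simp
      · nlinarith
  linarith

/-- The alternating sum of values of `B` along generalized pentagonal numbers, as a coefficient of a
product of generating functions. -/
theorem hasSum_coeff_mul_expand_pentagonalSeries {R : Type*} [CommRing R] [TopologicalSpace R]
    [IsTopologicalRing R] (N : ℕ) :
    HasSum (fun k : ℤ => ((((k.negOnePow : ℤˣ) : ℤ) *
        linAnalogueB (N - 6 * k * (3 * k + 1)) : ℤ) : R))
      (coeff N ((PowerSeries.mk fun n => (#(linAnalogueTriples n) : R)) *
        expand 12 (by norm_num) (pentagonalSeries R))) := by
  have h := (((WithPiTopology.hasSum_pentagonalSeries R).map (expand (R := R) 12 (by norm_num))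
    (continuous_expand R (by norm_num))).mul_left
      (PowerSeries.mk fun n => (#(linAnalogueTriples n) : R)))
  rw [WithPiTopology.hasSum_iff_hasSum_coeff] at h
  -- `pentagonal k` is `k * (3 * k - 1) / 2`, so the summation index changes sign.
  convert! (Equiv.neg ℤ).hasSum_iff.mpr (h N) using 1
  ext1 k
  have hk := two_mul_natCast_pentagonal_neg k
  simp only [Function.comp_apply, Equiv.neg_apply, map_mul, map_intCast, map_pow, expand_X,
    ← pow_mul, Int.negOnePow_neg]
  rw [mul_left_comm, ← map_intCast (C (R := R)), coeff_C_mul, coeff_mul_X_pow', coeff_mk,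
    Int.cast_mul, linAnalogueB]
  congr 1
  by_cases hN : 12 * pentagonal (-k) ≤ N
  · have hsub : (N : ℤ) - 6 * k * (3 * k + 1) = (N - 12 * pentagonal (-k) : ℕ) := by
      push_cast [hN]
      linear_combination 6 * hk
    rw [if_pos hN, hsub, if_neg (by omega), Int.toNat_natCast, Int.cast_natCast]
  · rw [if_neg hN, if_pos, Int.cast_zero]
    have : (N : ℤ) < 12 * pentagonal (-k) := by exact_mod_cast not_le.mp hN
    linarith

theorem theorem1p3 (n j : ℕ) (hj : j = 1 ∨ j = 2) :
    (Function.support fun k : ℤ =>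
      ((k.negOnePow : ℤˣ) : ℤ) * linAnalogueB (9 * n + 3 * j + 2 - 6 * k * (3 * k + 1))).Finite ∧
    (∑ᶠ k : ℤ,
      ((k.negOnePow : ℤˣ) : ℤ) * linAnalogueB (9 * n + 3 * j + 2 - 6 * k * (3 * k + 1)))
      ≡ 0 [ZMOD 3] := by
  have hfin := finite_support_negOnePow_mul_linAnalogueB (9 * n + 3 * j + 2)
  refine ⟨hfin, ?_⟩
  let _ : TopologicalSpace (ZMod 3) := ⊥
  have _ : DiscreteTopology (ZMod 3) := ⟨rfl⟩
  have hsum := hasSum_coeff_mul_expand_pentagonalSeries (R := ZMod 3) (9 * n + 3 * j + 2)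
  rw [coeff_linAnalogueTriples_mul_expand_eq_zero hj] at hsum
  push_cast at hsum
  refine (ZMod.intCast_eq_intCast_iff _ _ 3).mp ?_
  rw [finsum_eq_sum _ hfin, Int.cast_sum, Int.cast_zero]
  refine (hasSum_sum_of_ne_finset_zero (L := .unconditional ℤ) fun k hk => ?_).unique
    (by simpa using hsum)
  rw [Set.Finite.mem_toFinset, Function.notMem_support] at hk
  rw [hk, Int.cast_zero]
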